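/- Let $R$ be a ring and $N\in\mathbb N$ (with $N=0$ allowed). An $N$-complex of $R$-modules is a diagram $\cdots\to X^{i-1}\xrightarrow{d}X^i\xrightarrow{d}X^{i+1}\to\cdots$ of $R$-modules indexed by $\mathbb Z$ with $d^N=0$; with degreewise maps commuting with $d$ these form the category $C_N(\mathrm{Mod}_R)$. For $1\le r\le N-1$ and $i\in\mathbb Z$ put $H^i_{(r)}(X)=\ker(d^r\colon X^i\to X^{i+r})/\operatorname{im}(d^{N-r}\colon X^{i-N+r}\to X^i)$. A morphism $f$ is an $N$-quasi-isomorphism if $H^i_{(r)}(f)$ is an isomorphism for all $i\in\mathbb Z$ and $1\le r\le N-1$. For $0\le r\le N$ and $i\in\mathbb Z$ let $\mu_r^i(R)$ be the $N$-complex that is $R$ in the degrees $j$ with $i-r<j\le i$, with identity maps between these degrees, and is zero in all other degrees. Let $$J=\{0\to\mu_N^i(R)\mid i\in\mathbb Z\},\qquad I=J\cup\{\mu_r^i(R)\to\mu_N^i(R)\mid i\in\mathbb Z,\ 0<r<N\},$$ where the morphism $\mu_r^i(R)\to\mu_N^i(R)$ is the identity of $R$ in the degrees where both complexes are $R$ and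 is zero in all other degrees. **Theorem.** There is a model structure on $C_N(\mathrm{Mod}_R)$ that is cofibrantly generated with generating cofibrations $I$ and generating trivial cofibrations $J$, whose weak equivalences are precisely the $N$-quasi-isomorphisms, whose fibrations are precisely the levelwise epimorphisms, and whose trivial fibrations are precisely the levelwise surjective $N$-quasi-isomorphisms. Here "model structure" and "cofibrantly generated" have Hovey's meaning: $C_N(\mathrm{Mod}_R)$ has all small limits and colimits, the factorizations of the model structure are functorial, the domains of $I$ (respectively $J$) are small relative to the relative $I$-cell complexes (respectively $J$-cell complexes), the fibrations are exactly the morphisms with the right lifting property with respect to $J$, and the trivial fibrations are exactly the morphisms with the right lifting property with respect to $I$. -/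

import Mathlib

open CategoryTheory CategoryTheory.Limits HomotopicalAlgebra
open scoped ZeroObject

universe w v u

noncomputable section

/-! ## N-complexes -/

section NComplexes

variable (C : Type u) [Category.{v} C]

/-- An `∞`-complex in `C`, i.e. a diagram `⋯ ⟶ Xⁱ⁻¹ ⟶ Xⁱ ⟶ Xⁱ⁺¹ ⟶ ⋯` indexed by `ℤ`, is a functor
`X : ℤ ⥤ C` on the poset `ℤ`. Its differential is `X.map (i ⟶ i + 1)`, and the iterate
`d ^ n : Xⁱ ⟶ Xⁱ⁺ⁿ` is `X.map (i ⟶ i + n)`. -/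
abbrev InftyComplex := ℤ ⥤ C

variable {C}

/-- The iterated differential `dⁿ : Xⁱ ⟶ Xⁱ⁺ⁿ` of an `∞`-complex. -/
abbrev InftyComplex.dPow (X : InftyComplex C) (n : ℕ) (i : ℤ) : X.obj i ⟶ X.obj (i + n) :=
  X.map (homOfLE (by lia))

lemma InftyComplex.dPow_zero (X : InftyComplex C) (i : ℤ) :
    InftyComplex.dPow X 0 i = eqToHom (by simp) := by
  have h : i = i + ((0 : ℕ) : ℤ) := by simp
  rw [← eqToHom_map X h]
  congr 1

lemma InftyComplex.dPow_succ (X : InftyComplex C) (n : ℕ) (i : ℤ) :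
    InftyComplex.dPow X (n + 1) i =
      InftyComplex.dPow X n i ≫ InftyComplex.dPow X 1 (i + n) ≫
        eqToHom (by push_cast; rw [add_assoc]) := by
  have h : i + (n : ℤ) + ((1 : ℕ) : ℤ) = i + ((n + 1 : ℕ) : ℤ) := by push_cast; ring
  rw [← eqToHom_map X h, ← X.map_comp, ← X.map_comp]
  congr 1

variable (C) [HasZeroMorphisms C]

/-- An `∞`-complex `X` is an `N`-complex if `d ^ N = 0`. -/
def isNComplex (N : ℕ) : ObjectProperty (InftyComplex C) :=
  fun X ↦ ∀ i : ℤ, InftyComplex.dPow X N i = 0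

/-- The category `C_N(C)` of `N`-complexes: a full subcategory of the category of `∞`-complexes. -/
abbrev NComplex (N : ℕ) := (isNComplex C N).FullSubcategory

variable {C}

lemma isNComplex.map_eq_zero {N : ℕ} {X : InftyComplex C} (hX : isNComplex C N X)
    {j k : ℤ} (h : j + N ≤ k) : X.map (homOfLE (show j ≤ k by lia)) = 0 := by
  have : homOfLE (show j ≤ k by lia) = homOfLE (show j ≤ j + N by lia) ≫ homOfLE h := rfl
  rw [this, X.map_comp]
  have h0 : X.map (homOfLE (show j ≤ j + N by lia)) = 0 := hX j
  rw [h0, zero_comp]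

instance [HasZeroObject C] (N : ℕ) : (isNComplex C N).ContainsZero where
  exists_zero := ⟨(Functor.const ℤ).obj 0,
    Functor.isZero _ (fun _ ↦ isZero_zero C), fun _ ↦ (isZero_zero C).eq_of_src _ _⟩

end NComplexes

/-! ## The complexes `μ_n^i(M)` -/

section Mu

variable {C : Type u} [Category.{v} C] [HasZeroObject C]

open scoped Classical in
/-- `M` if `p` holds and the zero object otherwise. -/
def objIf (p : Prop) (M : C) : C := if p then M else 0

lemma objIf_of_true {p : Prop} (hp : p) (M : C) : objIf p M = M := by simp [objIf, hp]

lemma isZero_objIf {p : Prop} (hp : ¬ p) (M : C) : IsZero (objIf p M) := by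
  simp [objIf, hp, isZero_zero]

variable [HasZeroMorphisms C]

open scoped Classical in
/-- The morphism `objIf p M ⟶ objIf q M` which is the identity of `M` if source and target
are both `M`, and zero otherwise. -/
def homIf (p q : Prop) (M : C) : objIf p M ⟶ objIf q M :=
  if h : p ∧ q then eqToHom (by simp [objIf, h.1, h.2]) else 0

lemma homIf_self (p : Prop) (M : C) : homIf p p M = 𝟙 _ := by
  by_cases hp : p
  · simp [homIf, hp]
  · exact (isZero_objIf hp M).eq_of_src _ _

lemma homIf_of_not {p q : Prop} (h : ¬ (p ∧ q)) (M : C) : homIf p q M = 0 := by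
  simp only [homIf, dif_neg h]

lemma homIf_comp {p q r : Prop} (h : p → r → q) (M : C) :
    homIf p q M ≫ homIf q r M = homIf p r M := by
  by_cases hp : p
  · by_cases hr : r
    · have hq := h hp hr
      simp [homIf, hp, hq, hr]
    · exact (isZero_objIf hr M).eq_of_tgt _ _
  · exact (isZero_objIf hp M).eq_of_src _ _

/-- The `∞`-complex `μ_n^i(M)`: the object `M` in the degrees `i - n + 1, …, i` with identities as
differentials between them, and zero elsewhere. -/
def muInfty (n : ℕ) (i : ℤ) (M : C) : InftyComplex C where
  obj j := objIf (i - n < j ∧ j ≤ i) M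
  map {j k} _ := homIf (i - n < j ∧ j ≤ i) (i - n < k ∧ k ≤ i) M
  map_id _ := homIf_self _ _
  map_comp f g := by
    have hf := leOfHom f
    have hg := leOfHom g
    exact (homIf_comp (by lia) M).symm

lemma muInfty_isNComplex {n N : ℕ} (h : n ≤ N) (i : ℤ) (M : C) :
    isNComplex C N (muInfty n i M) := by
  intro j
  exact homIf_of_not (by lia) M

/-- `μ_n^i(M)` as an `N`-complex, for `n ≤ N`. -/
def mu {n N : ℕ} (h : n ≤ N) (i : ℤ) (M : C) : NComplex C N :=
  ⟨muInfty n i M, muInfty_isNComplex h i M⟩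

/-- The morphism `μ_r^i(M) ⟶ μ_N^i(M)` which is the identity of `M` in the degrees where source
and target are both `M`, and zero elsewhere. -/
def muHom {r N : ℕ} (h : r ≤ N) (i : ℤ) (M : C) :
    (mu h i M : NComplex C N) ⟶ mu le_rfl i M :=
  ObjectProperty.homMk
    { app := fun j ↦ homIf (i - r < j ∧ j ≤ i) (i - N < j ∧ j ≤ i) M
      naturality := fun j k f ↦ by
        have hf := leOfHom f
        exact (homIf_comp (p := i - r < j ∧ j ≤ i) (q := i - r < k ∧ k ≤ i)
            (r := i - N < k ∧ k ≤ i) (by lia) M).trans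
          (homIf_comp (p := i - r < j ∧ j ≤ i) (q := i - N < j ∧ j ≤ i)
            (r := i - N < k ∧ k ≤ i) (by lia) M).symm }

end Mu

/-! ## Cohomology and `N`-quasi-isomorphisms -/

section Cohomology

variable {A : Type u} [Category.{v} A] [Abelian A] {N : ℕ}

/-- The short complex `X^{i-(N-r)} ⟶ Xⁱ ⟶ X^{i+r}` with maps `d^{N-r}` and `d^r`. -/
@[simps]
def NComplex.sc (r : ℕ) (hr : r ≤ N) (i : ℤ) : NComplex A N ⥤ ShortComplex A where
  obj X :=
    { f := X.obj.map (homOfLE (show i - ((N : ℤ) - r) ≤ i by lia))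
      g := InftyComplex.dPow X.obj r i
      zero := by
        rw [← X.obj.map_comp]
        exact X.property.map_eq_zero (by lia) }
  map φ :=
    { τ₁ := φ.hom.app _
      τ₂ := φ.hom.app _
      τ₃ := φ.hom.app _ }

/-- The cohomology functor `H_{(r)}^i = ker (d^r)^i / im (d^{N-r})^i`. -/
def NComplex.cohomology (r : ℕ) (hr : r ≤ N) (i : ℤ) : NComplex A N ⥤ A :=
  NComplex.sc r hr i ⋙ ShortComplex.homologyFunctor A

variable (A N)

/-- `N`-quasi-isomorphisms: `H_{(r)}^i(f)` is an isomorphism for all `i` and `1 ≤ r ≤ N - 1`. -/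
def nQuasiIso : MorphismProperty (NComplex A N) :=
  fun _ _ f ↦ ∀ (i : ℤ) (r : ℕ) (_ : 1 ≤ r) (hr : r < N),
    IsIso ((NComplex.cohomology r hr.le i).map f)

/-- Morphisms of `N`-complexes that are epimorphisms in each degree. -/
def levelwiseEpi : MorphismProperty (NComplex A N) :=
  fun _ _ f ↦ ∀ i : ℤ, Epi (f.hom.app i)

end Cohomology

/-! ## Cofibrantly generated model structures -/

section CofibrantlyGenerated

variable {C : Type u} [Category.{v} C]

/-- A totally ordered set is `κ`-filtered if it has no greatest element and each
subset of cardinality at most `κ` is bounded. -/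
def IsKappaFiltered (κ : Cardinal.{w}) (J : Type w) [LinearOrder J] : Prop :=
  NoMaxOrder J ∧ ∀ S : Set J, Cardinal.mk S ≤ κ → BddAbove S

/-- `A` is small relative to the class `D`: there is a cardinal `κ` such that, for each `κ`-filtered
well-ordered `J` and each colimit-preserving sequence `F : J ⥤ C` whose successive maps
`F j ⟶ F (j + 1)` lie in `D`, the functor `Hom(A, -)` preserves the colimit of `F`. -/
def IsSmallRelativeTo (A : C) (D : MorphismProperty C) : Prop :=
  ∃ κ : Cardinal.{w}, ∀ (J : Type w) [LinearOrder J] [OrderBot J] [SuccOrder J] [WellFoundedLT J],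
    IsKappaFiltered κ J → ∀ {X Y : C} (f : X ⟶ Y) (h : D.TransfiniteCompositionOfShape J f),
      PreservesColimit h.F (coyoneda.obj (Opposite.op A))

/-- Relative `I`-cell complexes: transfinite compositions of pushouts of morphisms of `I`. -/
def relativeCells (I : MorphismProperty C) : MorphismProperty C :=
  MorphismProperty.transfiniteCompositions.{w} I.pushouts

variable (C) in
/-- A model structure (on a category with all small limits and colimits, and with functorial
factorizations) is cofibrantly generated by the sets `I` and `J` if the domains of `I` are small
relative to `I`-cell complexes, the domains of `J` are small relative to `J`-cell complexes, the
fibrations are the morphisms with the right lifting property with respect to `J`, and the trivial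
fibrations are those with the right lifting property with respect to `I`. -/
structure IsCofibrantlyGeneratedBy [ModelCategory C] (I J : MorphismProperty C) : Prop where
  hasLimits : HasLimitsOfSize.{w, w} C
  hasColimits : HasColimitsOfSize.{w, w} C
  factorization_trivialCofibrations :
    MorphismProperty.HasFunctorialFactorization (trivialCofibrations C) (fibrations C)
  factorization_trivialFibrations :
    MorphismProperty.HasFunctorialFactorization (cofibrations C) (trivialFibrations C)
  isSmall_I : MorphismProperty.IsSmall.{w} I
  isSmall_J : MorphismProperty.IsSmall.{w} J
  small_I : ∀ {A B : C} (f : A ⟶ B), I f → IsSmallRelativeTo.{w} A (relativeCells.{w} I)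
  small_J : ∀ {A B : C} (f : A ⟶ B), J f → IsSmallRelativeTo.{w} A (relativeCells.{w} J)
  fibrations_eq : fibrations C = J.rlp
  trivialFibrations_eq : trivialFibrations C = I.rlp

end CofibrantlyGenerated

/-! ## `N`-complexes of modules -/

section Modules

variable (R : Type u) [Ring R] (N : ℕ)

/-- `J`: the morphisms `0 ⟶ μ_N^i(R)`, for `i ∈ ℤ`. -/
def generatingTrivialCofibrations : MorphismProperty (NComplex (ModuleCat.{u} R) N) :=
  MorphismProperty.ofHoms fun i : ℤ ↦
    (0 : (0 : NComplex (ModuleCat.{u} R) N) ⟶ mu le_rfl i (ModuleCat.of R R))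

/-- `I`: the morphisms of `J` and the morphisms `μ_r^i(R) ⟶ μ_N^i(R)`, for `i ∈ ℤ`
and `0 < r < N`. -/
def generatingCofibrations : MorphismProperty (NComplex (ModuleCat.{u} R) N) :=
  generatingTrivialCofibrations R N ⊔
    MorphismProperty.ofHoms fun p : ℤ × {r : ℕ // 0 < r ∧ r < N} ↦
      muHom p.2.2.2.le p.1 (ModuleCat.of R R)

/-- Morphisms of `N`-complexes of modules that are surjective in each degree. -/
def levelwiseSurjective : MorphismProperty (NComplex (ModuleCat.{u} R) N) :=
  fun _ _ f ↦ ∀ i : ℤ, Function.Surjective (f.hom.app i)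

end Modules

end

noncomputable section

/-! ## Limits and colimits of `N`-complexes -/

section LimitsColimits

variable {C : Type u} [Category.{v} C] [HasZeroMorphisms C] (N : ℕ)

/-! A morphism from `mu` (of length n) to `X` is an element of `X`, in the lowest degree of `mu`,
that is killed by d^n (`exists_mu_hom`, `mu_hom_ext`). Lifting against `I` and `J` thereby becomes a
statement about elements. Against `J` it is levelwise surjectivity. Against the other maps of `I` it
says that d^r x = 0 and f(x) = d^{N-r} y imply x = d^{N-r} x' with f(x') = y. For levelwise
surjective f this amounts to being an N-quasi-isomorphism (`nQuasiIso_iff_of_surjective`).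

The domains of `I` and `J` are finitely presented, so the small object argument gives both
functorial factorizations. What remains is to identify the maps with the left lifting property
against all fibrations with the cofibrations that are N-quasi-isomorphisms
(`llp_rlp_generatingTrivialCofibrations`). Such a map f : X → Y has a retraction s, because X → 0 is
a fibration. Moreover 1 - fs vanishes on the image of f, so it lifts through a surjection from an
N-complex without cohomology (`acyclicCover`). Hence 1 - fs is zero on cohomology, and f is an
N-quasi-isomorphism. The converse is the retract argument. -/

instance isNComplex.isClosedUnderLimitsOfShape (J : Type*) [Category* J] [HasLimitsOfShape J C] :
    (isNComplex C N).IsClosedUnderLimitsOfShape J where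
  limitsOfShape_le := by
    rintro X ⟨p⟩ i
    refine (isLimitOfPreserves ((evaluation ℤ C).obj (i + N)) p.isLimit).hom_ext fun j ↦ ?_
    have h := (p.π.app j).naturality (homOfLE (show i ≤ i + N by lia))
    have h0 : (p.diag.obj j).map (homOfLE (show i ≤ i + N by lia)) = 0 := p.prop_diag_obj j i
    rw [h0, comp_zero] at h
    exact h.trans zero_comp.symm

instance isNComplex.isClosedUnderColimitsOfShape (J : Type*) [Category* J]
    [HasColimitsOfShape J C] :
    (isNComplex C N).IsClosedUnderColimitsOfShape J where
  colimitsOfShape_le := by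
    rintro X ⟨p⟩ i
    refine (isColimitOfPreserves ((evaluation ℤ C).obj i) p.isColimit).hom_ext fun j ↦ ?_
    have h := (p.ι.app j).naturality (homOfLE (show i ≤ i + N by lia))
    have h0 : (p.diag.obj j).map (homOfLE (show i ≤ i + N by lia)) = 0 := p.prop_diag_obj j i
    rw [h0, zero_comp] at h
    exact h.symm.trans comp_zero.symm

instance NComplex.hasLimitsOfSize [HasLimitsOfSize.{w, w} C] :
    HasLimitsOfSize.{w, w} (NComplex C N) :=
  ⟨fun J _ ↦ inferInstanceAs (HasLimitsOfShape J (isNComplex C N).FullSubcategory)⟩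

instance NComplex.hasColimitsOfSize [HasColimitsOfSize.{w, w} C] :
    HasColimitsOfSize.{w, w} (NComplex C N) :=
  ⟨fun J _ ↦ inferInstanceAs (HasColimitsOfShape J (isNComplex C N).FullSubcategory)⟩

end LimitsColimits

/-! ## Elements of `N`-complexes of modules -/

section Elements

variable {R : Type u} [Ring R] {N : ℕ}

namespace NComplex

/-- The composed differential `Xⁱ → Xʲ`, for `i ≤ j`. -/
def d (X : NComplex (ModuleCat.{u} R) N) {i j : ℤ} (h : i ≤ j) :
    X.obj.obj i →ₗ[R] X.obj.obj j :=
  (X.obj.map (homOfLE h)).hom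

variable {X Y : NComplex (ModuleCat.{u} R) N}

/-- The component of a morphism of `N`-complexes in degree `i`. -/
def comp (f : X ⟶ Y) (i : ℤ) : X.obj.obj i →ₗ[R] Y.obj.obj i := (f.hom.app i).hom

lemma d_self (i : ℤ) (x : X.obj.obj i) : X.d le_rfl x = x :=
  congr($(X.obj.map_id i) x)

lemma d_d {i j k : ℤ} (h : i ≤ j) (h' : j ≤ k) (x : X.obj.obj i) :
    X.d h' (X.d h x) = X.d (h.trans h') x :=
  (congr($(X.obj.map_comp (homOfLE h) (homOfLE h')) x)).symm

lemma d_eq_zero {i j : ℤ} (h : i + N ≤ j) (x : X.obj.obj i) :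
    X.d (show i ≤ j by lia) x = 0 :=
  congr($(X.property.map_eq_zero h) x)

lemma comp_d (f : X ⟶ Y) {i j : ℤ} (h : i ≤ j) (x : X.obj.obj i) :
    comp f j (X.d h x) = Y.d h (comp f i x) :=
  congr($(f.hom.naturality (homOfLE h)) x)

lemma comp_comp {Z : NComplex (ModuleCat.{u} R) N} (f : X ⟶ Y) (g : Y ⟶ Z) (i : ℤ)
    (x : X.obj.obj i) : comp (f ≫ g) i x = comp g i (comp f i x) := rfl

lemma comp_id (i : ℤ) (x : X.obj.obj i) : comp (𝟙 X) i x = x := rfl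

lemma hom_ext {f g : X ⟶ Y} (h : ∀ i x, comp f i x = comp g i x) : f = g := by
  apply ObjectProperty.hom_ext
  apply NatTrans.ext
  ext i x
  exact h i x

/-- Constructor for morphisms of `N`-complexes of modules. -/
def homMk (φ : ∀ i, X.obj.obj i →ₗ[R] Y.obj.obj i)
    (h : ∀ (i j : ℤ) (hij : i ≤ j) (x : X.obj.obj i), φ j (X.d hij x) = Y.d hij (φ i x)) :
    X ⟶ Y :=
  ObjectProperty.homMk
    { app i := ModuleCat.ofHom (φ i)
      naturality i j f := by
        ext x
        exact h i j (leOfHom f) x }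

lemma comp_homMk (φ : ∀ i, X.obj.obj i →ₗ[R] Y.obj.obj i)
    (h : ∀ (i j : ℤ) (hij : i ≤ j) (x : X.obj.obj i), φ j (X.d hij x) = Y.d hij (φ i x))
    (i : ℤ) : comp (homMk φ h) i = φ i := rfl

end NComplex

end Elements

/-! ## `N`-quasi-isomorphisms in terms of elements -/

section QuasiIso

variable {R : Type u} [Ring R]

lemma CategoryTheory.ShortComplex.moduleCat_exists_cycle {S : ShortComplex (ModuleCat.{u} R)}
    (x : S.X₂) (hx : S.g x = 0) : ∃ z : S.cycles, S.iCycles z = x := by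
  refine ⟨S.moduleCatCyclesIso.inv ⟨x, hx⟩, ?_⟩
  exact congr($(S.moduleCatCyclesIso_inv_iCycles) ⟨x, hx⟩)

lemma CategoryTheory.ShortComplex.moduleCat_homologyπ_eq_zero_iff
    {S : ShortComplex (ModuleCat.{u} R)} (z : S.cycles) :
    S.homologyπ z = 0 ↔ ∃ y, S.f y = S.iCycles z := by
  have hS : (ShortComplex.mk S.toCycles S.homologyπ (by simp)).Exact :=
    ShortComplex.exact_of_g_is_cokernel _ S.homologyIsCokernel
  have hi : Function.Injective S.iCycles := (ModuleCat.mono_iff_injective _).1 inferInstance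
  have e (y) : S.iCycles (S.toCycles y) = S.f y := congr($(S.toCycles_i) y)
  constructor
  · intro h
    obtain ⟨y, hy⟩ := (ShortComplex.moduleCat_exact_iff _).1 hS z h
    exact ⟨y, by rw [← e]; exact congr(S.iCycles $hy)⟩
  · rintro ⟨y, hy⟩
    rw [← e] at hy
    rw [← hi hy]
    exact congr($(S.toCycles_comp_homologyπ) y)

/-- The two clauses are injectivity and surjectivity on homology, tested on cycles; this suffices
because `homologyπ` is surjective. -/
lemma CategoryTheory.ShortComplex.moduleCat_isIso_homologyMap_iff
    {S T : ShortComplex (ModuleCat.{u} R)} (φ : S ⟶ T) :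
    IsIso (ShortComplex.homologyMap φ) ↔
      (∀ x, S.g x = 0 → (∃ y, T.f y = φ.τ₂ x) → ∃ y, S.f y = x) ∧
      (∀ x, T.g x = 0 → ∃ x', S.g x' = 0 ∧ ∃ y, x = φ.τ₂ x' + T.f y) := by
  have hn (z : S.cycles) : ShortComplex.homologyMap φ (S.homologyπ z) =
      T.homologyπ (ShortComplex.cyclesMap φ z) :=
    congr($(ShortComplex.homologyπ_naturality φ) z)
  have hi (z : S.cycles) : T.iCycles (ShortComplex.cyclesMap φ z) = φ.τ₂ (S.iCycles z) :=
    congr($(ShortComplex.cyclesMap_i φ) z)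
  have hg {S : ShortComplex (ModuleCat.{u} R)} (z : S.cycles) : S.g (S.iCycles z) = 0 :=
    congr($(S.iCycles_g) z)
  have hs {S : ShortComplex (ModuleCat.{u} R)} : Function.Surjective S.homologyπ :=
    (ModuleCat.epi_iff_surjective _).1 inferInstance
  rw [ConcreteCategory.isIso_iff_bijective]
  refine and_congr ?_ ?_
  · rw [injective_iff_map_eq_zero]
    constructor
    · rintro h x hx ⟨y, hy⟩
      obtain ⟨z, rfl⟩ := ShortComplex.moduleCat_exists_cycle x hx
      rw [← ShortComplex.moduleCat_homologyπ_eq_zero_iff]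
      apply h
      rw [hn, ShortComplex.moduleCat_homologyπ_eq_zero_iff]
      exact ⟨y, hy.trans (hi z).symm⟩
    · intro h w hw
      obtain ⟨z, rfl⟩ := hs w
      rw [hn, ShortComplex.moduleCat_homologyπ_eq_zero_iff, hi] at hw
      rw [ShortComplex.moduleCat_homologyπ_eq_zero_iff]
      exact h _ (hg z) hw
  · constructor
    · intro h x hx
      obtain ⟨z, rfl⟩ := ShortComplex.moduleCat_exists_cycle x hx
      obtain ⟨w, hw⟩ := h (T.homologyπ z)
      obtain ⟨z', rfl⟩ := hs w
      rw [hn] at hw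
      have : T.homologyπ (z - ShortComplex.cyclesMap φ z') = 0 := by
        rw [map_sub, hw, sub_self]
      rw [ShortComplex.moduleCat_homologyπ_eq_zero_iff] at this
      obtain ⟨y, hy⟩ := this
      refine ⟨S.iCycles z', hg z', y, ?_⟩
      rw [hy, ← hi, map_sub, add_sub_cancel]
    · intro h w
      obtain ⟨z, rfl⟩ := hs w
      obtain ⟨x', hx', y, hy⟩ := h _ (hg z)
      obtain ⟨z', rfl⟩ := ShortComplex.moduleCat_exists_cycle x' hx'
      refine ⟨S.homologyπ z', ?_⟩
      rw [hn, eq_comm, ← sub_eq_zero, ← map_sub, ShortComplex.moduleCat_homologyπ_eq_zero_iff]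
      refine ⟨y, ?_⟩
      rw [map_sub, hi, hy, add_sub_cancel_left]

variable {N : ℕ} {X Y : NComplex (ModuleCat.{u} R) N}

open NComplex

/-- A morphism is an `N`-quasi-isomorphism if and only if for all degrees `a ≤ b ≤ a + N`, its
maps `ker (d : Xᵇ → Xᵃ⁺ᴺ) / im (d : Xᵃ → Xᵇ)` are injective and surjective. -/
lemma nQuasiIso_iff (f : X ⟶ Y) :
    nQuasiIso (ModuleCat.{u} R) N f ↔ ∀ (a b c : ℤ) (hab : a < b) (hbc : b < c) (_ : c = a + N),
      (∀ x, X.d hbc.le x = 0 → (∃ y, Y.d hab.le y = comp f b x) → ∃ y, X.d hab.le y = x) ∧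
      (∀ x, Y.d hbc.le x = 0 → ∃ x', X.d hbc.le x' = 0 ∧ ∃ y, x = comp f b x' + Y.d hab.le y) := by
  have key (i : ℤ) (r : ℕ) (hr : r < N) :=
    ShortComplex.moduleCat_isIso_homologyMap_iff ((NComplex.sc r hr.le i).map f)
  constructor
  · intro hf a b c hab hbc hc
    obtain ⟨r, rfl⟩ := Int.le.dest hbc.le
    obtain rfl : a = b - ((N : ℤ) - r) := by lia
    exact (key b r (by lia)).1 (hf b r (by lia) (by lia))
  · intro h i r hr hr'
    exact (key i r hr').2 (h (i - ((N : ℤ) - r)) i (i + r) (by lia) (by lia) (by lia))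

instance nQuasiIso.hasTwoOutOfThreeProperty :
    (nQuasiIso (ModuleCat.{u} R) N).HasTwoOutOfThreeProperty where
  comp_mem f g hf hg i r hr hr' := by
    have := hf i r hr hr'
    have := hg i r hr hr'
    rw [Functor.map_comp]
    infer_instance
  of_postcomp f g hg hfg i r hr hr' := by
    have := hg i r hr hr'
    have := hfg i r hr hr'
    rw [Functor.map_comp] at this
    exact IsIso.of_isIso_comp_right _ ((NComplex.cohomology r hr'.le i).map g)
  of_precomp f g hf hfg i r hr hr' := by
    have := hf i r hr hr'
    have := hfg i r hr hr'
    rw [Functor.map_comp] at this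
    exact IsIso.of_isIso_comp_left ((NComplex.cohomology r hr'.le i).map f) _

lemma levelwiseEpi_iff (f : X ⟶ Y) :
    levelwiseEpi (ModuleCat.{u} R) N f ↔ ∀ i, Function.Surjective (comp f i) :=
  forall_congr' fun _ ↦ ModuleCat.epi_iff_surjective _

lemma levelwiseSurjective_eq_levelwiseEpi :
    levelwiseSurjective R N = levelwiseEpi (ModuleCat.{u} R) N := by
  ext X Y f
  exact (levelwiseEpi_iff f).symm

end QuasiIso

end

noncomputable section

/-! ## Morphisms from `μ_n^i(R)` -/

section MuUniversal

variable {R : Type u} [Ring R]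

open scoped Classical in
/-- The element `1` of `objIf p R` if `p` holds, and zero otherwise. -/
def oneIf (R : Type u) [Ring R] (p : Prop) : (objIf p (ModuleCat.of R R) : ModuleCat.{u} R) :=
  if h : p then (eqToHom (objIf_of_true h (ModuleCat.of R R)).symm).hom (1 : R) else 0

lemma oneIf_of_not {p : Prop} (h : ¬ p) : oneIf R p = 0 := dif_neg h

lemma exists_eq_smul_oneIf {p : Prop} (x : (objIf p (ModuleCat.of R R) : ModuleCat.{u} R)) :
    ∃ r : R, x = r • oneIf R p := by
  by_cases hp : p
  · let e := eqToIso (objIf_of_true hp (ModuleCat.of R R))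
    refine ⟨(e.hom.hom x : R), ?_⟩
    have h : oneIf R p = e.inv.hom (1 : R) := dif_pos hp
    rw [h, ← map_smul, smul_eq_mul, mul_one]
    exact congr($(e.hom_inv_id.symm) x)
  · have := ModuleCat.subsingleton_of_isZero (isZero_objIf hp (ModuleCat.of R R))
    exact ⟨0, Subsingleton.elim _ _⟩

lemma homIf_oneIf {p q : Prop} (h : q → p) :
    (homIf p q (ModuleCat.of R R)).hom (oneIf R p) = oneIf R q := by
  by_cases hq : q
  · have hp := h hq
    rw [homIf, dif_pos ⟨hp, hq⟩, oneIf, dif_pos hp, oneIf, dif_pos hq]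
    exact congr($(eqToHom_trans (objIf_of_true hp (ModuleCat.of R R)).symm
      ((objIf_of_true hp _).trans (objIf_of_true hq _).symm)) (1 : R))
  · have := ModuleCat.subsingleton_of_isZero (isZero_objIf hq (ModuleCat.of R R))
    exact Subsingleton.elim _ _

open scoped Classical in
/-- The linear map from `objIf p R` sending the generator to `m`. -/
def descIf (p : Prop) {M : ModuleCat.{u} R} (m : M) :
    (objIf p (ModuleCat.of R R) : ModuleCat.{u} R) →ₗ[R] M :=
  if h : p then (eqToHom (objIf_of_true h (ModuleCat.of R R)) ≫
    ModuleCat.ofHom (LinearMap.toSpanSingleton R M m)).hom else 0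

lemma descIf_oneIf {p : Prop} {M : ModuleCat.{u} R} (m : M) (hm : ¬ p → m = 0) :
    descIf p m (oneIf R p) = m := by
  by_cases hp : p
  · let e := eqToIso (objIf_of_true hp (ModuleCat.of R R))
    have h : oneIf R p = e.inv.hom (1 : R) := dif_pos hp
    have h' : descIf p m = (LinearMap.toSpanSingleton R M m).comp e.hom.hom := dif_pos hp
    have h'' : e.hom.hom (e.inv.hom (1 : R)) = (1 : R) := congr($(e.inv_hom_id) (1 : R))
    rw [h, h', LinearMap.comp_apply, h'', LinearMap.toSpanSingleton_apply, one_smul]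
  · rw [oneIf_of_not hp, map_zero, hm hp]

lemma linearMap_ext_oneIf {p : Prop} {M : Type*} [AddCommGroup M] [Module R M]
    {f g : (objIf p (ModuleCat.of R R) : ModuleCat.{u} R) →ₗ[R] M}
    (h : f (oneIf R p) = g (oneIf R p)) : f = g := by
  ext x
  obtain ⟨r, rfl⟩ := exists_eq_smul_oneIf x
  rw [map_smul, map_smul, h]

variable {N : ℕ}

namespace NComplex

/-- The element `1` of `μ_n^i(R)` in degree `j`. -/
def muOne (R : Type u) [Ring R] {n N : ℕ} (h : n ≤ N) (i j : ℤ) :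
    (mu h i (ModuleCat.of R R) : NComplex (ModuleCat.{u} R) N).obj.obj j :=
  oneIf R (i - n < j ∧ j ≤ i)

variable {n : ℕ} (h : n ≤ N) (i : ℤ) {X Y : NComplex (ModuleCat.{u} R) N}

lemma d_muOne {j k : ℤ} (hjk : j ≤ k) (hj : i - n < j) :
    NComplex.d _ hjk (muOne R h i j) = muOne R h i k :=
  homIf_oneIf fun hk ↦ ⟨hj, hjk.trans hk.2⟩

variable {i} in
-- The complex is generated by the element 1 in its lowest degree `a`.
lemma mu_hom_ext {a : ℤ} (ha : a = i - n + 1)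
    {f g : mu h i (ModuleCat.of R R) ⟶ X}
    (hfg : comp f a (muOne R h i a) = comp g a (muOne R h i a)) : f = g := by
  apply NComplex.hom_ext
  intro j
  refine LinearMap.congr_fun (linearMap_ext_oneIf ?_)
  change comp f j (muOne R h i j) = comp g j (muOne R h i j)
  by_cases hj : i - n < j
  · rw [← d_muOne h i (show a ≤ j by lia) (by lia), comp_d, comp_d, hfg]
  · have : muOne R h i j = 0 := oneIf_of_not (fun h ↦ hj h.1)
    rw [this, map_zero, map_zero]

variable {i} in
-- The generator in degree `a` satisfies the single relation d^n = 0. For n = N this relation holds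
-- in every N-complex, so any element of degree `a` is allowed.
lemma exists_mu_hom {a b : ℤ} (ha : a = i - n + 1) (hb : b = i + 1) (x : X.obj.obj a)
    (hx : X.d (show a ≤ b by lia) x = 0) :
    ∃ f : mu h i (ModuleCat.of R R) ⟶ X, comp f a (muOne R h i a) = x := by
  classical
  let y (j : ℤ) : X.obj.obj j := if hj : a ≤ j then X.d hj x else 0
  have hy (j : ℤ) (hj : ¬ (i - n < j ∧ j ≤ i)) : y j = 0 := by
    by_cases haj : a ≤ j
    · simp only [y, dif_pos haj]
      rw [← d_d (show a ≤ b by lia) (show b ≤ j by lia), hx, map_zero]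
    · simp only [y, dif_neg haj]
  let φ (j : ℤ) : (mu h i (ModuleCat.of R R)).obj.obj j →ₗ[R] X.obj.obj j := descIf _ (y j)
  have hφ (j : ℤ) : φ j (muOne R h i j) = y j := descIf_oneIf _ (hy j)
  refine ⟨homMk φ ?_, ?_⟩
  · intro j k hjk
    refine LinearMap.congr_fun (f := (φ k).comp (NComplex.d _ hjk)) (g := (X.d hjk).comp (φ j))
      (linearMap_ext_oneIf ?_)
    change φ k (NComplex.d _ hjk (muOne R h i j)) = X.d hjk (φ j (muOne R h i j))
    rw [hφ]
    by_cases hj : a ≤ j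
    · rw [d_muOne h i hjk (by lia), hφ]
      simp only [y, dif_pos hj, dif_pos (hj.trans hjk), d_d]
    · have : muOne R h i j = 0 := oneIf_of_not (by lia)
      rw [this, map_zero, map_zero, hy j (by lia), map_zero]
  · rw [comp_homMk, hφ]
    simp only [y, dif_pos le_rfl, d_self]

variable {i} in
lemma d_comp_muOne {a b : ℤ} (ha : a = i - n + 1) (hb : b = i + 1)
    (f : mu h i (ModuleCat.of R R) ⟶ X) :
    X.d (show a ≤ b by lia) (comp f a (muOne R h i a)) = 0 := by
  rw [← comp_d, d_muOne h i _ (by lia)]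
  have : muOne R h i b = 0 := oneIf_of_not (by lia)
  rw [this, map_zero]

lemma comp_muHom_muOne {a : ℤ} (ha : i - n < a) :
    comp (muHom h i (ModuleCat.of R R)) a (muOne R h i a) = muOne R le_rfl i a :=
  homIf_oneIf fun h ↦ ⟨ha, h.2⟩

end NComplex

end MuUniversal

/-! ## Morphisms with the right lifting property -/

section Lifting

variable {R : Type u} [Ring R] {N : ℕ} {X Y : NComplex (ModuleCat.{u} R) N}

open NComplex

lemma hasLiftingProperty_zero_mu_iff (f : X ⟶ Y) (i : ℤ) :
    HasLiftingProperty (0 : (0 : NComplex (ModuleCat.{u} R) N) ⟶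
      mu le_rfl i (ModuleCat.of R R)) f ↔ Function.Surjective (comp f (i - N + 1)) := by
  constructor
  · intro _ y
    obtain ⟨g, rfl⟩ := exists_mu_hom le_rfl rfl rfl y (d_eq_zero (by lia) y)
    have sq : CommSq (0 : (0 : NComplex (ModuleCat.{u} R) N) ⟶ X) 0 f g :=
      ⟨(isZero_zero _).eq_of_src _ _⟩
    refine ⟨comp sq.lift _ (muOne R le_rfl i _), ?_⟩
    rw [← comp_comp, sq.fac_right]
  · intro h
    refine ⟨fun {t b} sq ↦ ⟨?_⟩⟩
    obtain ⟨x, hx⟩ := h (comp b _ (muOne R le_rfl i _))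
    obtain ⟨g, rfl⟩ := exists_mu_hom le_rfl rfl rfl x (d_eq_zero (by lia) x)
    exact ⟨{
      l := g
      fac_left := (isZero_zero _).eq_of_src _ _
      fac_right := mu_hom_ext le_rfl rfl hx }⟩

lemma rlp_generatingTrivialCofibrations :
    (generatingTrivialCofibrations R N).rlp = levelwiseEpi (ModuleCat.{u} R) N := by
  ext X Y f
  rw [levelwiseEpi_iff]
  constructor
  · intro h i
    obtain ⟨j, rfl⟩ : ∃ j, i = j - N + 1 := ⟨i + N - 1, by lia⟩
    exact (hasLiftingProperty_zero_mu_iff f j).1 (h _ ⟨j⟩)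
  · rintro h _ _ _ ⟨j⟩
    exact (hasLiftingProperty_zero_mu_iff f j).2 (h _)

/-- The top and bottom of a square are elements `x` and `y`, and its commutativity is `Y.d _ y =
comp f b x`, since `muHom` sends the generator in degree `b` to the image of the generator in degree
`a`. -/
lemma hasLiftingProperty_muHom_iff (f : X ⟶ Y) {r : ℕ} (hr : r ≤ N) {i a b c : ℤ}
    (ha : a = i - N + 1) (hb : b = i - r + 1) (hc : c = i + 1) :
    HasLiftingProperty (muHom hr i (ModuleCat.of R R)) f ↔
      ∀ (x : X.obj.obj b) (y : Y.obj.obj a), X.d (show b ≤ c by lia) x = 0 →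
        Y.d (show a ≤ b by lia) y = comp f b x →
        ∃ x', X.d (show a ≤ b by lia) x' = x ∧ comp f a x' = y := by
  have e : NComplex.d _ (show a ≤ b by lia) (muOne R le_rfl i a) =
    comp (muHom hr i (ModuleCat.of R R)) b (muOne R hr i b) := by
    rw [comp_muHom_muOne hr i (by lia), d_muOne le_rfl i _ (by lia)]
  constructor
  · intro _ x y hx hxy
    obtain ⟨t, rfl⟩ := exists_mu_hom hr hb hc x hx
    obtain ⟨g, rfl⟩ := exists_mu_hom le_rfl ha hc y (d_eq_zero (by lia) y)
    have sq : CommSq t (muHom hr i (ModuleCat.of R R)) f g := ⟨by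
      apply mu_hom_ext hr hb
      rw [comp_comp, ← hxy, comp_comp, ← e, comp_d]⟩
    refine ⟨comp sq.lift _ (muOne R le_rfl i a), ?_, ?_⟩
    · rw [← comp_d, e, ← comp_comp, sq.fac_left]
    · rw [← comp_comp, sq.fac_right]
  · intro h
    refine ⟨fun {t g} sq ↦ ⟨?_⟩⟩
    obtain ⟨x', hx', hy⟩ := h (comp t b (muOne R hr i b)) (comp g a (muOne R le_rfl i a))
      (d_comp_muOne hr hb hc t) (by rw [← comp_comp, sq.w, comp_comp, ← e, comp_d])
    obtain ⟨l, rfl⟩ := exists_mu_hom le_rfl ha hc x' (d_eq_zero (by lia) x')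
    exact ⟨{
      l := l
      fac_left := mu_hom_ext hr hb (by rw [comp_comp, ← e, comp_d, hx'])
      fac_right := mu_hom_ext le_rfl ha hy }⟩

/-- A morphism which is surjective in each degree has the right lifting property with respect to the
morphisms `μ_r^i(R) ⟶ μ_N^i(R)` if and only if it is an `N`-quasi-isomorphism. -/
lemma nQuasiIso_iff_of_surjective (f : X ⟶ Y) (hf : ∀ i, Function.Surjective (comp f i)) :
    nQuasiIso (ModuleCat.{u} R) N f ↔ ∀ (a b c : ℤ) (hab : a < b) (hbc : b < c) (_ : c = a + N)
      (x : X.obj.obj b) (y : Y.obj.obj a), X.d hbc.le x = 0 → Y.d hab.le y = comp f b x →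
        ∃ x', X.d hab.le x' = x ∧ comp f a x' = y := by
  rw [nQuasiIso_iff]
  constructor
  · intro h a b c hab hbc hc x y hx hxy
    obtain ⟨x₁, rfl⟩ := (h a b c hab hbc hc).1 x hx ⟨y, hxy⟩
    obtain ⟨x₂, hx₂, y', hy'⟩ := (h (b - N) a b (by lia) hab (by lia)).2 (comp f a x₁ - y) (by
      rw [map_sub, hxy, comp_d, sub_self])
    obtain ⟨x₃, rfl⟩ := hf _ y'
    -- Neither correction changes the differential in degree `b`: `x₂` is a cycle, and `x₃` starts
    -- `N` degrees below `b`.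
    refine ⟨x₁ - x₂ - X.d (by lia) x₃, ?_, ?_⟩
    · rw [map_sub, map_sub, hx₂, d_d, sub_zero, d_eq_zero (show b - N + N ≤ b by lia), sub_zero]
    · rw [map_sub, map_sub, comp_d, sub_sub, ← hy', sub_sub_cancel]
  · intro h a b c hab hbc hc
    constructor
    · rintro x hx ⟨y, hy⟩
      obtain ⟨x', hx', -⟩ := h a b c hab hbc hc x y hx hy
      exact ⟨x', hx'⟩
    · intro y hy
      -- In the next window with `x = 0`, the lifting condition lifts cycles of degree `b` to
      -- cycles.
      obtain ⟨x', hx', hx''⟩ := h b c (b + N) hbc (by lia) rfl 0 y (map_zero _)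
        (by rw [hy, map_zero])
      exact ⟨x', hx', 0, by rw [hx'', map_zero, add_zero]⟩

lemma rlp_generatingCofibrations :
    (generatingCofibrations R N).rlp =
      levelwiseEpi (ModuleCat.{u} R) N ⊓ nQuasiIso (ModuleCat.{u} R) N := by
  ext X Y f
  rw [← rlp_generatingTrivialCofibrations]
  constructor
  · intro h
    have hJ : (generatingTrivialCofibrations R N).rlp f := fun _ _ g hg ↦ h g (Or.inl hg)
    refine ⟨hJ, ?_⟩
    rw [rlp_generatingTrivialCofibrations, levelwiseEpi_iff] at hJ
    rw [nQuasiIso_iff_of_surjective f hJ]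
    intro a b c hab hbc hc
    obtain ⟨r, rfl⟩ := Int.le.dest hbc.le
    have hr : 0 < r ∧ r < N := by lia
    -- This top degree makes μ_r start in degree `b` and end just before `c = b + r`.
    exact (hasLiftingProperty_muHom_iff f (i := b + r - 1) hr.2.le (by lia) (by lia) (by lia)).1
      (h _ (Or.inr ⟨(⟨b + r - 1, r, hr⟩ : ℤ × {r : ℕ // 0 < r ∧ r < N})⟩))
  · rintro ⟨hJ, hW⟩ _ _ g (hg | ⟨⟨i, r, hr⟩⟩)
    · exact hJ g hg
    · rw [rlp_generatingTrivialCofibrations, levelwiseEpi_iff] at hJ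
      rw [nQuasiIso_iff_of_surjective f hJ] at hW
      exact (hasLiftingProperty_muHom_iff f hr.2.le rfl rfl rfl).2
        (hW _ _ _ (by lia) (by lia) (by lia))

end Lifting

end

noncomputable section

/-! ## Smallness of the domains -/

section Smallness

lemma CategoryTheory.Limits.IsZero.preservesColimit_coyoneda {C : Type*} [Category* C]
    [HasZeroMorphisms C] {Z : C} (hZ : IsZero Z) {J : Type*} [Category* J] [IsFiltered J]
    (F : J ⥤ C) : PreservesColimit F (coyoneda.obj (Opposite.op Z)) where
  preserves _ := ⟨Types.FilteredColimit.isColimitOf' _ _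
    (fun _ ↦ ⟨IsFiltered.nonempty.some, (0 : Z ⟶ _), hZ.eq_of_src _ _⟩)
    (fun j _ _ _ ↦ ⟨j, 𝟙 j, hZ.eq_of_src _ _⟩)⟩

variable {R : Type u} [Ring R] {N : ℕ}

open NComplex

/-- With one generator and one relation, `mu` is finitely presented, and filtered colimits of
N-complexes are computed degreewise. -/
lemma NComplex.preservesColimit_coyoneda_mu {n : ℕ} (h : n ≤ N) (i : ℤ)
    {J : Type u} [SmallCategory J] [IsFiltered J] (F : J ⥤ NComplex (ModuleCat.{u} R) N) :
    PreservesColimit F (coyoneda.obj (Opposite.op (mu h i (ModuleCat.of R R)))) where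
  preserves {c} hc := by
    let E (a : ℤ) : NComplex (ModuleCat.{u} R) N ⥤ ModuleCat.{u} R :=
      (isNComplex (ModuleCat.{u} R) N).ι ⋙ (evaluation ℤ _).obj a
    have hE (a : ℤ) : IsColimit ((E a).mapCocone c) := isColimitOfPreserves (E a) hc
    have exists_rep {a : ℤ} (x : c.pt.obj.obj a) :
        ∃ (j : J) (y : (F.obj j).obj.obj a), comp (c.ι.app j) a y = x :=
      Concrete.isColimit_exists_rep (F ⋙ E a) (hE a) x
    have exists_eq {a : ℤ} {j : J} (x y : (F.obj j).obj.obj a)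
        (hxy : comp (c.ι.app j) a x = comp (c.ι.app j) a y) :
        ∃ (k : J) (f : j ⟶ k), comp (F.map f) a x = comp (F.map f) a y := by
      obtain ⟨k, f, g, hk⟩ := Concrete.isColimit_exists_of_rep_eq (F ⋙ E a) (hE a) x y hxy
      replace hk : comp (F.map f) a x = comp (F.map g) a y := hk
      refine ⟨IsFiltered.coeq f g, f ≫ IsFiltered.coeqHom f g, ?_⟩
      nth_rw 2 [IsFiltered.coeq_condition]
      rw [F.map_comp, F.map_comp, comp_comp, comp_comp, hk]
    refine ⟨Types.FilteredColimit.isColimitOf' _ _ (fun x ↦ ?_) (fun j x y hxy ↦ ?_)⟩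
    · change mu h i (ModuleCat.of R R) ⟶ c.pt at x
      obtain ⟨j, y, hy⟩ := exists_rep (comp x (i - n + 1) (muOne R h i _))
      -- The relation is known only in the colimit for the representative `y`; it holds after
      -- passing to a later stage `k`.
      obtain ⟨k, f, hk⟩ := exists_eq (NComplex.d _ (show i - n + 1 ≤ i + 1 by lia) y) 0 (by
        rw [comp_d, hy, d_comp_muOne h rfl rfl, map_zero])
      obtain ⟨g, hg⟩ := exists_mu_hom h rfl rfl (comp (F.map f) _ y) (by
        rw [← comp_d, hk, map_zero])
      refine ⟨k, g, mu_hom_ext h rfl ?_⟩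
      change _ = comp (g ≫ c.ι.app k) _ _
      rw [comp_comp, hg, ← comp_comp, c.w, hy]
    · change mu h i (ModuleCat.of R R) ⟶ F.obj j at x y
      obtain ⟨k, f, hk⟩ := exists_eq (comp x (i - n + 1) (muOne R h i _))
        (comp y (i - n + 1) (muOne R h i _))
        congr(comp (X := mu h i (ModuleCat.of R R)) $hxy (i - n + 1) (muOne R h i _))
      exact ⟨k, f, mu_hom_ext h rfl hk⟩

lemma generatingTrivialCofibrations_le_generatingCofibrations :
    generatingTrivialCofibrations R N ≤ generatingCofibrations R N := le_sup_left

lemma preservesColimit_coyoneda_of_generatingCofibrations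
    {A B : NComplex (ModuleCat.{u} R) N} {f : A ⟶ B} (hf : generatingCofibrations R N f)
    {J : Type u} [SmallCategory J] [IsFiltered J] (F : J ⥤ NComplex (ModuleCat.{u} R) N) :
    PreservesColimit F (coyoneda.obj (Opposite.op A)) := by
  obtain ⟨⟨i⟩⟩ | ⟨⟨i, r, hr⟩⟩ := hf
  · exact (isZero_zero _).preservesColimit_coyoneda F
  · exact preservesColimit_coyoneda_mu hr.2.le i F

instance : MorphismProperty.IsSmall.{u} (generatingTrivialCofibrations R N) := by
  have : Small.{u} ℤ := Countable.toSmall _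
  exact MorphismProperty.isSmall_ofHoms _

instance : MorphismProperty.IsSmall.{u} (generatingCofibrations R N) := by
  have : Small.{u} (ℤ × {r : ℕ // 0 < r ∧ r < N}) := Countable.toSmall _
  let K := MorphismProperty.ofHoms fun p : ℤ × {r : ℕ // 0 < r ∧ r < N} ↦
    (muHom p.2.2.2.le p.1 (ModuleCat.of R R) : (_ : NComplex (ModuleCat.{u} R) N) ⟶ _)
  have : MorphismProperty.IsSmall.{u} K := MorphismProperty.isSmall_ofHoms _
  exact ⟨small_union (generatingTrivialCofibrations R N).toSet K.toSet⟩

lemma hasSmallObjectArgument_of_le {K : MorphismProperty (NComplex (ModuleCat.{u} R) N)}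
    [MorphismProperty.IsSmall.{u} K] (hK : K ≤ generatingCofibrations R N) :
    MorphismProperty.HasSmallObjectArgument.{u} K := by
  have : Fact Cardinal.aleph0.{u}.IsRegular := ⟨Cardinal.isRegular_aleph0⟩
  have : Nonempty Cardinal.aleph0.{u}.ord.ToType := by simp
  let := WellFoundedLT.toOrderBot Cardinal.aleph0.{u}.ord.ToType
  exact ⟨Cardinal.aleph0, inferInstance, inferInstance,
    { preservesColimit _ hi _ hf :=
        preservesColimit_coyoneda_of_generatingCofibrations (hK _ hi) hf.F }⟩

instance : MorphismProperty.HasSmallObjectArgument.{u} (generatingTrivialCofibrations R N) :=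
  hasSmallObjectArgument_of_le generatingTrivialCofibrations_le_generatingCofibrations

instance : MorphismProperty.HasSmallObjectArgument.{u} (generatingCofibrations R N) :=
  hasSmallObjectArgument_of_le le_rfl

lemma isSmallRelativeTo_of_generatingCofibrations
    {A B : NComplex (ModuleCat.{u} R) N} {f : A ⟶ B} (hf : generatingCofibrations R N f)
    (D : MorphismProperty (NComplex (ModuleCat.{u} R) N)) : IsSmallRelativeTo.{u} A D :=
  ⟨Cardinal.aleph0, fun _ _ _ _ _ _ _ _ _ h ↦
    preservesColimit_coyoneda_of_generatingCofibrations hf h.F⟩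

end Smallness

/-! ## An acyclic `N`-complex mapping onto a given `N`-complex -/

section AcyclicCover

variable {R : Type u} [Ring R] {N : ℕ}

namespace NComplex

variable (Y : NComplex (ModuleCat.{u} R) N)

/-- The families of elements of `Yʲ` which vanish unless `i - N < j ≤ i`. -/
def acyclicCoverObj (i : ℤ) : Submodule R (∀ j : ℤ, Y.obj.obj j) where
  carrier := {g | ∀ j, ¬ (i - N < j ∧ j ≤ i) → g j = 0}
  add_mem' hg hg' j hj := by rw [Pi.add_apply, hg j hj, hg' j hj, add_zero]
  zero_mem' _ _ := rfl
  smul_mem' r g hg j hj := by rw [Pi.smul_apply, hg j hj, smul_zero]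

/-- The map forgetting the elements in degrees `≤ k - N`. -/
def acyclicCoverMap {i k : ℤ} (h : i ≤ k) : acyclicCoverObj Y i →ₗ[R] acyclicCoverObj Y k :=
  LinearMap.codRestrict _
    ((LinearMap.pi fun j ↦ if k - N < j then LinearMap.proj j else 0) ∘ₗ
      (acyclicCoverObj Y i).subtype) (fun g j hj ↦ by
      rw [LinearMap.comp_apply, LinearMap.pi_apply]
      split_ifs with hk
      · exact g.2 j (by lia)
      · rfl)

lemma acyclicCoverMap_apply {i k : ℤ} (h : i ≤ k) (g : acyclicCoverObj Y i) (j : ℤ) :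
    (acyclicCoverMap Y h g).1 j = if k - N < j then g.1 j else 0 := by
  change (if k - N < j then LinearMap.proj j else 0 : (∀ j : ℤ, Y.obj.obj j) →ₗ[R] _) g.1 = _
  split_ifs <;> rfl

/-- The acyclic `N`-complex `⨁ⱼ μ_N^{j+N-1}(Yʲ)`. -/
def acyclicCover : NComplex (ModuleCat.{u} R) N where
  obj :=
    { obj i := ModuleCat.of R (acyclicCoverObj Y i)
      map f := ModuleCat.ofHom (acyclicCoverMap Y (leOfHom f))
      map_id i := by
        ext g j
        refine (acyclicCoverMap_apply Y le_rfl g j).trans ?_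
        split_ifs with hj
        · rfl
        · exact (g.2 j (by lia)).symm
      map_comp {i k l} f f' := by
        have hf := leOfHom f
        have hf' := leOfHom f'
        ext g j
        refine (acyclicCoverMap_apply Y (hf.trans hf') g j).trans
          (Eq.trans ?_ (acyclicCoverMap_apply Y hf' (acyclicCoverMap Y hf g) j).symm)
        rw [acyclicCoverMap_apply]
        split_ifs <;> first | rfl | lia }
  property i := by
    ext g j
    refine (acyclicCoverMap_apply Y (show i ≤ i + N by lia) g j).trans ?_
    split_ifs with hj
    · exact g.2 j (by lia)
    · rfl

/-- A family in the kernel is supported in `b - N < j ≤ a`, so the same family already lives in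
degree `a` and is its own preimage. -/
lemma acyclicCover_exact {a b c : ℤ} (hab : a ≤ b) (hbc : b ≤ c) (hc : c = a + N)
    (x : (acyclicCover Y).obj.obj b) (hx : (acyclicCover Y).d hbc x = 0) :
    ∃ y, (acyclicCover Y).d hab y = x := by
  change acyclicCoverObj Y b at x
  have hx' (j : ℤ) (hj : c - N < j) : x.1 j = 0 := by
    have h := congr_fun (congr_arg Subtype.val hx) j
    replace h : (acyclicCoverMap Y hbc x).1 j = 0 := h
    rwa [acyclicCoverMap_apply, if_pos hj] at h
  refine ⟨(⟨x.1, fun j hj ↦ ?_⟩ : acyclicCoverObj Y a), Subtype.ext (funext fun j ↦ ?_)⟩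
  · by_cases hja : a < j
    · exact hx' j (by lia)
    · exact x.2 j (by lia)
  · refine (acyclicCoverMap_apply Y hab _ j).trans ?_
    split_ifs with hj
    · rfl
    · exact (x.2 j (by lia)).symm

/-- The composed differential `Yⁱ → Yʲ`, extended by zero to `i > j`. -/
def dOrZero (i j : ℤ) : Y.obj.obj i →ₗ[R] Y.obj.obj j :=
  if h : i ≤ j then Y.d h else 0

variable {Y} in
lemma d_dOrZero {i j k : ℤ} (hij : i ≤ j) (hjk : j ≤ k) (x : Y.obj.obj i) :
    Y.d hjk (dOrZero Y i j x) = dOrZero Y i k x := by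
  rw [dOrZero, dif_pos hij, dOrZero, dif_pos (hij.trans hjk), d_d]

/-- The morphism onto `Y` from its acyclic cover, sending a family `g` to `∑ⱼ d^{i-j}(gⱼ)`. -/
def acyclicCoverπ : acyclicCover Y ⟶ Y :=
  homMk (fun i ↦ (∑ j ∈ Finset.Ioc (i - N) i, dOrZero Y j i ∘ₗ LinearMap.proj j) ∘ₗ
    (acyclicCoverObj Y i).subtype) (by
  intro i k hik (g : acyclicCoverObj Y i)
  change (∑ j ∈ Finset.Ioc (k - N) k, dOrZero Y j k ∘ₗ LinearMap.proj j)
    (acyclicCoverMap Y hik g).1 = Y.d hik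
      ((∑ j ∈ Finset.Ioc (i - N) i, dOrZero Y j i ∘ₗ LinearMap.proj j) g.1)
  simp only [LinearMap.sum_apply, map_sum, LinearMap.comp_apply, LinearMap.proj_apply]
  -- Both sides are compared over the union of the two ranges: the terms with `j ≤ k - N` vanish
  -- because d^N = 0, those with `j > i` because `g` is zero there.
  trans ∑ j ∈ Finset.Ioc (i - N) k, dOrZero Y j k (g.1 j)
  · refine (Finset.sum_congr rfl fun j hj ↦ ?_).trans
      (Finset.sum_subset (Finset.Ioc_subset_Ioc_left (by lia)) fun j hj hj' ↦ ?_)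
    · rw [acyclicCoverMap_apply, if_pos (Finset.mem_Ioc.1 hj).1]
    · rw [Finset.mem_Ioc] at hj hj'
      rw [dOrZero, dif_pos hj.2, d_eq_zero (by lia)]
  · refine ((Finset.sum_congr rfl fun j hj ↦ ?_).trans
      (Finset.sum_subset (Finset.Ioc_subset_Ioc_right hik) fun j hj hj' ↦ ?_)).symm
    · rw [d_dOrZero (Finset.mem_Ioc.1 hj).2]
    · rw [Finset.mem_Ioc] at hj hj'
      rw [g.2 j (by lia), map_zero])

lemma acyclicCoverπ_surjective (i : ℤ) : Function.Surjective (comp (acyclicCoverπ Y) i) := by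
  intro y
  by_cases hN : N = 0
  -- For `N = 0` the support interval is empty, so no family is concentrated in degree `i`; but then
  -- `Y` is zero.
  · refine ⟨0, ?_⟩
    rw [map_zero, ← d_self i y, d_eq_zero (by lia)]
  · refine ⟨(⟨Pi.single i y, fun j hj ↦ Pi.single_eq_of_ne (by lia) _⟩ : acyclicCoverObj Y i), ?_⟩
    change (∑ j ∈ Finset.Ioc (i - N) i, dOrZero Y j i ∘ₗ LinearMap.proj j) (Pi.single i y) = y
    rw [LinearMap.sum_apply, Finset.sum_eq_single i]
    · simp only [LinearMap.comp_apply, LinearMap.proj_apply, Pi.single_eq_same]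
      rw [dOrZero, dif_pos le_rfl, d_self]
    · intro j _ hj
      rw [LinearMap.comp_apply, LinearMap.proj_apply, Pi.single_eq_of_ne hj, map_zero]
    · intro h
      exact (h (Finset.mem_Ioc.2 (by lia))).elim

end NComplex

end AcyclicCover

/-! ## The model structure -/

section ModelStructure

variable (R : Type u) [Ring R] (N : ℕ)

open NComplex

/-- The retraction `s` gives injectivity on cohomology. Surjectivity holds because `g = 1 - fs`
factors through `acyclicCover`. -/
lemma llp_levelwiseEpi_le_nQuasiIso :
    (levelwiseEpi (ModuleCat.{u} R) N).llp ≤ nQuasiIso (ModuleCat.{u} R) N := by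
  intro X Y f hf
  have h₀ : levelwiseEpi (ModuleCat.{u} R) N (0 : X ⟶ 0) := by
    intro i
    have hz : IsZero ((0 : NComplex (ModuleCat.{u} R) N).obj.obj i) := by
      rw [IsZero.iff_id_eq_zero]
      exact congr(($((isZero_zero (NComplex (ModuleCat.{u} R) N)).eq_of_src (𝟙 _) 0)).hom.app i)
    exact ⟨fun _ _ _ ↦ hz.eq_of_src _ _⟩
  have := hf _ h₀
  have sq : CommSq (𝟙 X) f (0 : X ⟶ 0) 0 := ⟨by simp⟩
  let s := sq.lift
  have hs : f ≫ s = 𝟙 X := sq.fac_left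
  have hs' (i : ℤ) (x) : comp s i (comp f i x) = x := by rw [← comp_comp, hs, comp_id]
  have := hf _ ((levelwiseEpi_iff _).2 (acyclicCoverπ_surjective Y))
  let g : Y ⟶ Y := homMk (fun i ↦ LinearMap.id - comp f i ∘ₗ comp s i) (fun i j hij y ↦ by
    simp only [LinearMap.sub_apply, LinearMap.comp_apply, LinearMap.id_apply, map_sub, comp_d])
  have hg (i : ℤ) (y) : comp g i y = y - comp f i (comp s i y) := rfl
  have sq' : CommSq 0 f (acyclicCoverπ Y) g := ⟨NComplex.hom_ext fun i x ↦ by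
    rw [comp_comp f, hg, hs', sub_self, zero_comp]
    rfl⟩
  let l := sq'.lift
  have hl (i : ℤ) (y) : comp (acyclicCoverπ Y) i (comp l i y) = y - comp f i (comp s i y) := by
    rw [← hg, ← comp_comp, sq'.fac_right]
  rw [nQuasiIso_iff]
  intro a b c hab hbc hc
  constructor
  · rintro x _ ⟨y, hy⟩
    exact ⟨comp s a y, by rw [← comp_d, hy, hs']⟩
  · intro y hy
    -- The lift of the cycle `y` is a cycle in an acyclic complex, hence a boundary; projecting to
    -- `Y` shows that `y - f(s(y))` is a boundary.
    obtain ⟨q, hq⟩ := acyclicCover_exact Y hab.le hbc.le hc (comp l b y)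
      (by rw [← comp_d, hy, map_zero])
    refine ⟨comp s b y, by rw [← comp_d, hy, map_zero], comp (acyclicCoverπ Y) a q, ?_⟩
    rw [← comp_d, hq, hl, add_sub_cancel]

lemma llp_rlp_generatingTrivialCofibrations :
    (generatingTrivialCofibrations R N).rlp.llp =
      (generatingCofibrations R N).rlp.llp ⊓ nQuasiIso (ModuleCat.{u} R) N := by
  refine le_antisymm (le_inf ?_ ?_) ?_
  · exact MorphismProperty.antitone_llp (MorphismProperty.antitone_rlp
      generatingTrivialCofibrations_le_generatingCofibrations)
  · rw [rlp_generatingTrivialCofibrations]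
    exact llp_levelwiseEpi_le_nQuasiIso R N
  · rintro X Y f ⟨hf, hW⟩
    let h := MorphismProperty.factorizationData (generatingTrivialCofibrations R N).rlp.llp
      (generatingTrivialCofibrations R N).rlp f
    have hi : nQuasiIso (ModuleCat.{u} R) N h.i :=
      llp_levelwiseEpi_le_nQuasiIso R N _ (by
        rw [← rlp_generatingTrivialCofibrations]
        exact h.hi)
    have hp : nQuasiIso (ModuleCat.{u} R) N h.p :=
      MorphismProperty.of_precomp _ h.i h.p hi (by rwa [h.fac])
    have := hf h.p (by
      rw [rlp_generatingCofibrations, ← rlp_generatingTrivialCofibrations]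
      exact ⟨h.hp, hp⟩)
    -- `h.p` is a trivial fibration by two-out-of-three, so `f` lifts against it and is a retract of
    -- `h.i`.
    exact MorphismProperty.of_retract (RetractArrow.ofLeftLiftingProperty h.fac) h.hi

lemma isWeakFactorizationSystem_of_hasSmallObjectArgument {C : Type u} [Category.{v} C]
    (K : MorphismProperty C) [MorphismProperty.HasSmallObjectArgument.{w} K] :
    MorphismProperty.IsWeakFactorizationSystem K.rlp.llp K.rlp :=
  .mk' _ _ fun _ p hi hp ↦ hi p hp

end ModelStructure

end

theorem mainTheorem10 (R : Type u) [Ring R] (N : ℕ) :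
    ∃ _ : ModelCategory (NComplex (ModuleCat.{u} R) N),
      IsCofibrantlyGeneratedBy.{u} (NComplex (ModuleCat.{u} R) N)
        (generatingCofibrations R N) (generatingTrivialCofibrations R N) ∧
      weakEquivalences (NComplex (ModuleCat.{u} R) N) = nQuasiIso (ModuleCat.{u} R) N ∧
      fibrations (NComplex (ModuleCat.{u} R) N) = levelwiseEpi (ModuleCat.{u} R) N ∧
      trivialFibrations (NComplex (ModuleCat.{u} R) N) =
        levelwiseSurjective R N ⊓ nQuasiIso (ModuleCat.{u} R) N := by
  let I := generatingCofibrations R N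
  let J := generatingTrivialCofibrations R N
  let : CategoryWithFibrations (NComplex (ModuleCat.{u} R) N) := ⟨levelwiseEpi _ N⟩
  -- The cofibrations are forced as the maps with the left lifting property against trivial
  -- fibrations.
  let : CategoryWithCofibrations (NComplex (ModuleCat.{u} R) N) := ⟨I.rlp.llp⟩
  let : CategoryWithWeakEquivalences (NComplex (ModuleCat.{u} R) N) := ⟨nQuasiIso _ N⟩
  have hF : fibrations (NComplex (ModuleCat.{u} R) N) = J.rlp :=
    rlp_generatingTrivialCofibrations.symm
  have hTF : trivialFibrations (NComplex (ModuleCat.{u} R) N) = I.rlp :=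
    rlp_generatingCofibrations.symm
  have hC : cofibrations (NComplex (ModuleCat.{u} R) N) = I.rlp.llp := rfl
  have hTC : trivialCofibrations (NComplex (ModuleCat.{u} R) N) = J.rlp.llp :=
    (llp_rlp_generatingTrivialCofibrations R N).symm
  have : (weakEquivalences (NComplex (ModuleCat.{u} R) N)).HasTwoOutOfThreeProperty :=
    nQuasiIso.hasTwoOutOfThreeProperty
  have : MorphismProperty.IsWeakFactorizationSystem
      (cofibrations (NComplex (ModuleCat.{u} R) N)) (trivialFibrations _) := by
    rw [hC, hTF]
    exact isWeakFactorizationSystem_of_hasSmallObjectArgument _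
  have : MorphismProperty.IsWeakFactorizationSystem
      (trivialCofibrations (NComplex (ModuleCat.{u} R) N)) (fibrations _) := by
    rw [hTC, hF]
    exact isWeakFactorizationSystem_of_hasSmallObjectArgument _
  have : HasFiniteLimits (NComplex (ModuleCat.{u} R) N) :=
    hasFiniteLimits_of_hasLimitsOfSize.{u, u} _
  have : HasFiniteColimits (NComplex (ModuleCat.{u} R) N) :=
    hasFiniteColimits_of_hasColimitsOfSize.{u, u} _
  let M : ModelCategory (NComplex (ModuleCat.{u} R) N) := ModelCategory.mk' _
  refine ⟨M, ?_, rfl, rfl, ?_⟩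
  · exact {
      hasLimits := inferInstance
      hasColimits := inferInstance
      factorization_trivialCofibrations := by
        change MorphismProperty.HasFunctorialFactorization
          (trivialCofibrations (NComplex (ModuleCat.{u} R) N)) (fibrations _)
        rw [hTC, hF]
        infer_instance
      factorization_trivialFibrations := by
        change MorphismProperty.HasFunctorialFactorization
          (cofibrations (NComplex (ModuleCat.{u} R) N)) (trivialFibrations _)
        rw [hC, hTF]
        infer_instance
      isSmall_I := inferInstance
      isSmall_J := inferInstance
      small_I f hf := isSmallRelativeTo_of_generatingCofibrations hf _
      small_J f hf := isSmallRelativeTo_of_generatingCofibrations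
        (generatingTrivialCofibrations_le_generatingCofibrations f hf) _
      fibrations_eq := hF
      trivialFibrations_eq := hTF }
  · rw [levelwiseSurjective_eq_levelwiseEpi]
    rfl
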